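/- All rings are commutative with $1$. A ring $R$ is *von Neumann regular* if for every $a\in R$ there is $b\in R$ with $aba=a$. A ring $R$ is *real closed* if it is reduced and: (1) the squares of $R$ are exactly the nonnegative elements of a partial order on $R$ that makes $R$ an $f$-ring (a lattice-ordered ring in which $a\wedge b=0$ and $c\ge 0$ imply $ca\wedge b=0$); (2) for this order, $0\le a\le b$ implies $b\mid a^2$; (3) for every prime ideal $\mathfrak p$ of $R$, the domain $R/\mathfrak p$ is integrally closed in its field of fractions, and this field is a real closed field. We write $\mathrm{Qf}(D)$ for the field of fractions of a domain $D$ and $T(A)$ for the total quotient ring of a ring $A$ (the localization at all non-zero-divisors). **Theorem.** (i) Let $A$ be a reduced ring that is a subring of, and integrally closed in, a real closed von Neumann regular ring $B$. Let $f\in A[X]$ and $g\in B[X]$ be monic polynomials of odd degree. Then $f$ has a zero in $A$ and $g$ has a zero in $B$. (ii) Let $A$ and $B$ be as in (i), and let $\mathfrak p$ be a prime ideal of $B$. Then the canonical map $A/(\mathfrak p\cap A)\to B/\mathfrak p$ extends to an embedding $\mathrm{Qf}(A/(\mathfrak p\cap A))\to B/\mathfrak p$, the field $\mathrm{Qf}(A/(\mathfrak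 p\cap A))$ is algebraically closed in $B/\mathfrak p$ (every element of $B/\mathfrak p$ that is algebraic over it belongs to it), and $\mathrm{Qf}(A/(\mathfrak p\cap A))$ is a real closed field. (iii) Let $A$ be any reduced ring such that $T(A)$ is von Neumann regular. Then for every prime ideal $\mathfrak p$ of $T(A)$ one has $\mathrm{Qf}(A/(\mathfrak p\cap A))=T(A)/\mathfrak p$, i.e. the canonical map $A/(\mathfrak p\cap A)\to T(A)/\mathfrak p$ extends to an isomorphism $\mathrm{Qf}(A/(\mathfrak p\cap A))\cong T(A)/\mathfrak p$. If moreover $A$ is integrally closed in a real closed von Neumann regular ring $B$ as in (i), and $T(A)$ is an intermediate ring of $A$ and $B$, i.e. $A\subseteq T(A)\subseteq B$, then $T(A)$ is a real closed ring. -/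

import Mathlib

universe u v w

/-- A commutative ring is von Neumann regular if every element `a` has a quasi-inverse `b`,
that is, `a * b * a = a`. -/
def IsVonNeumannRegularRing (R : Type*) [CommRing R] : Prop :=
  ∀ a : R, ∃ b : R, a * b * a = a

/-- An `f`-ring: a lattice-ordered ring in which `a ⊓ b = 0` and `0 ≤ c` imply
`(c * a) ⊓ b = 0`. -/
structure IsFRing (R : Type*) [CommRing R] [Lattice R] : Prop where
  isOrderedRing : IsOrderedRing R
  mul_inf_eq_zero : ∀ a b c : R, a ⊓ b = 0 → 0 ≤ c → (c * a) ⊓ b = 0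

/-- Real closed rings (in the sense of N. Schwartz): reduced commutative rings such that
* the squares are the nonnegative elements of a partial order that makes the ring an `f`-ring,
* `0 ≤ a ≤ b` implies `b ∣ a ^ 2` for that order,
* for every prime ideal `p`, the domain `R ⧸ p` is integrally closed (in its field of fractions)
  and its field of fractions is a real closed field. -/
structure IsRealClosedRing (R : Type*) [CommRing R] : Prop where
  isReduced : IsReduced R
  exists_order : ∃ _ : Lattice R, IsFRing R ∧ (∀ a : R, 0 ≤ a ↔ IsSquare a) ∧
    ∀ a b : R, 0 ≤ a → a ≤ b → b ∣ a ^ 2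
  isIntegrallyClosed_quotient : ∀ (p : Ideal R) [p.IsPrime], IsIntegrallyClosed (R ⧸ p)
  isRealClosed_fractionRing : ∀ (p : Ideal R) [p.IsPrime], IsRealClosed (FractionRing (R ⧸ p))

/-- `Qf(A/(p ∩ A))`, for a prime ideal `p` of an `A`-algebra `B`, where `p ∩ A` is the preimage
of `p` in `A`. -/
abbrev QfRestrict (A : Type*) {B : Type*} [CommRing A] [CommRing B] [Algebra A B]
    (p : Ideal B) : Type _ :=
  FractionRing (A ⧸ p.comap (algebraMap A B))

/-- A ring homomorphism `Qf(A/(p ∩ A)) → B/p` is the canonical one if it sends the class of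
each `a : A` to the class of its image in `B`. There is at most one such homomorphism. -/
def IsCanonicalQfMap (A : Type*) {B : Type*} [CommRing A] [CommRing B] [Algebra A B]
    (p : Ideal B) (φ : QfRestrict A p →+* B ⧸ p) : Prop :=
  ∀ a : A, φ (algebraMap (A ⧸ p.comap (algebraMap A B)) (QfRestrict A p)
    (Ideal.Quotient.mk (p.comap (algebraMap A B)) a)) = Ideal.Quotient.mk p (algebraMap A B a)

/-! In a von Neumann regular ring primes are maximal and idempotents glue local solutions, so a
polynomial with a zero modulo every maximal ideal has a zero. The residue fields of `B` are real
closed, which gives odd-degree zeros in `B`; zeros of monic polynomials over `A` then lie in `A` by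
integral closedness.

Cutting off by idempotents carries integral closedness over to the image of `A` in `B ⧸ p`, and
clearing denominators makes the fraction field relatively algebraically closed there, hence real
closed.

For `T(A)`, denominators are units, so it too is integrally closed in `B`. Suprema, infima and
square roots are zeros of monic polynomials, so the order of `B` restricts to it. Its primes are
minimal, hence contracted from `B`, which reduces the residue fields to the previous case. -/

open Polynomial

namespace IsVonNeumannRegularRing

variable {R : Type*} [CommRing R]

theorem isMaximal_of_isPrime (hR : IsVonNeumannRegularRing R) (p : Ideal R) [hp : p.IsPrime] :
    p.IsMaximal := by
  refine Ideal.isMaximal_iff.2 ⟨fun h => hp.ne_top ((Ideal.eq_top_iff_one p).2 h), ?_⟩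
  intro J x hpJ hxp hxJ
  obtain ⟨y, hy⟩ := hR x
  have h0 : x * (1 - x * y) ∈ p := by
    have : x * (1 - x * y) = 0 := by linear_combination -hy
    rw [this]
    exact p.zero_mem
  have h1 : 1 - x * y ∈ J := hpJ ((hp.mem_or_mem h0).resolve_left hxp)
  simpa using J.add_mem h1 (J.mul_mem_right y hxJ)

/-- For a prime `p` there is an idempotent outside `p` annihilating a given element of `p`. -/
theorem exists_idempotent_mul_eq_zero (hR : IsVonNeumannRegularRing R) {p : Ideal R} {c : R}
    (hc : c ∈ p) : ∃ e : R, e * e = e ∧ e * c = 0 ∧ 1 - e ∈ p := by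
  obtain ⟨d, hd⟩ := hR c
  refine ⟨1 - c * d, by linear_combination d * hd, by linear_combination -hd, ?_⟩
  simpa using p.mul_mem_right d hc

/-- Evaluating a polynomial commutes with an idempotent cut-off of the argument. -/
theorem _root_.Polynomial.mul_eval_eq_mul_eval_of_mul_eq (g : R[X]) {e x y : R}
    (h : e * x = e * y) : e * g.eval x = e * g.eval y := by
  obtain ⟨k, hk⟩ := g.sub_dvd_eval_sub x y
  linear_combination e * hk + k * h

/-- A polynomial over a von Neumann regular ring which has a zero modulo every maximal ideal has
a zero. -/
theorem exists_isRoot_of_forall_isMaximal (hR : IsVonNeumannRegularRing R) (g : R[X])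
    (hg : ∀ m : Ideal R, m.IsMaximal → ∃ b, g.eval b ∈ m) : ∃ b, g.IsRoot b := by
  let I : Ideal R :=
    { carrier := {x | ∃ b, x * g.eval b = 0}
      zero_mem' := ⟨0, zero_mul _⟩
      smul_mem' := by
        rintro c x ⟨b, hb⟩
        exact ⟨b, by rw [smul_eq_mul, mul_assoc, hb, mul_zero]⟩
      add_mem' := by
        rintro x y ⟨b, hb⟩ ⟨c, hc⟩
        -- The idempotent `x * z` generates the same ideal as `x`. The glued point agrees with `b`
        -- where it is `1` and with `c` on the complement.
        obtain ⟨z, hz⟩ := hR x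
        have h1 := g.mul_eval_eq_mul_eval_of_mul_eq (e := x * z)
          (x := x * z * b + (1 - x * z) * c) (y := b) (by linear_combination (z * b - z * c) * hz)
        have h2 := g.mul_eval_eq_mul_eval_of_mul_eq (e := 1 - x * z)
          (x := x * z * b + (1 - x * z) * c) (y := c) (by linear_combination (z * c - z * b) * hz)
        refine ⟨x * z * b + (1 - x * z) * c, ?_⟩
        generalize g.eval (x * z * b + (1 - x * z) * c) = w at h1 h2
        linear_combination (x + y) * h1 + y * h2 + z * (x + y) * hb + (1 - x * z) * hc - w * hz }
  have hI : I = ⊤ := by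
    by_contra hne
    obtain ⟨m, hm, hIm⟩ := Ideal.exists_le_maximal I hne
    obtain ⟨b, hb⟩ := hg m hm
    obtain ⟨e, -, he, hem⟩ := hR.exists_idempotent_mul_eq_zero hb
    refine hm.ne_top ((Ideal.eq_top_iff_one m).2 ?_)
    simpa using m.add_mem hem (hIm (show e ∈ I from ⟨b, he⟩))
  obtain ⟨b, hb⟩ := (Ideal.eq_top_iff_one I).1 hI
  exact ⟨b, by simpa using hb⟩

end IsVonNeumannRegularRing

/-- A field that is relatively algebraically closed in a real closed field is real closed. -/
theorem IsRealClosed.of_ringHom {K L : Type*} [Field K] [Field L] [IsRealClosed L] (φ : K →+* L)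
    (hφ : ∀ x : L, (∃ h : K[X], h ≠ 0 ∧ h.eval₂ φ x = 0) → x ∈ φ.range) : IsRealClosed K where
  one_add_ne_zero := by
    intro s hs h
    refine IsSemireal.one_add_ne_zero (R := L) (s := φ s) ?_
      (by rw [← map_one φ, ← map_add, h, map_zero])
    clear h
    induction hs with
    | zero => simp
    | sq_add a _ ih => rw [map_add, map_mul]; exact .sq_add _ ih
  isSquare_or_isSquare_neg := by
    have key : ∀ x : K, IsSquare (φ x) → IsSquare x := by
      rintro x ⟨s, hs⟩
      obtain ⟨t, rfl⟩ := hφ s ⟨X ^ 2 - C x, X_pow_sub_C_ne_zero two_pos x, by simp [hs, sq]⟩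
      exact ⟨t, φ.injective (by rw [hs, map_mul])⟩
    intro x
    refine (IsRealClosed.isSquare_or_isSquare_neg (φ x)).imp (key x) fun h => key (-x) ?_
    rwa [map_neg]
  exists_isRoot_of_odd_natDegree := by
    intro f hf
    have hf0 : f ≠ 0 := by rintro rfl; simp at hf
    obtain ⟨x, hx⟩ := IsRealClosed.exists_isRoot_of_odd_natDegree (f := f.map φ)
      (by rwa [natDegree_map])
    rw [IsRoot, eval_map] at hx
    obtain ⟨t, rfl⟩ := hφ x ⟨f, hf0, hx⟩
    exact ⟨t, φ.injective (by rw [map_zero, ← hx, eval₂_hom])⟩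

theorem IsRealClosed.quotient_of_fractionRing {B : Type*} [CommRing B] (p : Ideal B)
    [hp : p.IsMaximal] (h : IsRealClosed (FractionRing (B ⧸ p))) :
    letI := Ideal.Quotient.field p
    IsRealClosed (B ⧸ p) := by
  let := Ideal.Quotient.field p
  have hb : Function.Surjective (algebraMap (B ⧸ p) (FractionRing (B ⧸ p))) :=
    IsFractionRing.surjective_iff_isField.2 (Field.toIsField _)
  exact IsRealClosed.of_ringHom (algebraMap (B ⧸ p) (FractionRing (B ⧸ p))) fun x _ => hb x

/-- Odd degree monic polynomials over a real closed von Neumann regular ring have zeros. -/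
theorem IsRealClosedRing.exists_isRoot_of_odd_natDegree {B : Type*} [CommRing B]
    (hB : IsVonNeumannRegularRing B) (hrc : IsRealClosedRing B) {g : B[X]} (hg : g.Monic)
    (hodd : Odd g.natDegree) : ∃ b, g.IsRoot b := by
  refine hB.exists_isRoot_of_forall_isMaximal g fun m hm => ?_
  let := Ideal.Quotient.field m
  have := IsRealClosed.quotient_of_fractionRing m (hrc.isRealClosed_fractionRing m)
  obtain ⟨x, hx⟩ := IsRealClosed.exists_isRoot_of_odd_natDegree
    (f := g.map (Ideal.Quotient.mk m)) (by rwa [hg.natDegree_map])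
  obtain ⟨b, rfl⟩ := Ideal.Quotient.mk_surjective x
  refine ⟨b, Ideal.Quotient.eq_zero_iff_mem.1 ?_⟩
  rwa [IsRoot, eval_map, eval₂_hom] at hx

theorem IsIntegrallyClosedIn.exists_algebraMap_eq_of_eval₂_eq_zero {A B : Type*} [CommRing A]
    [CommRing B] [Algebra A B] (hAB : IsIntegrallyClosedIn A B) {f : A[X]} (hf : f.Monic) {b : B}
    (hb : f.eval₂ (algebraMap A B) b = 0) : ∃ a : A, algebraMap A B a = b :=
  (IsIntegrallyClosedIn.isIntegral_iff (R := A)).1 ⟨f, hf, hb⟩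

section QfRestrict

variable {A B : Type*} [CommRing A] [CommRing B] [Algebra A B]

/-- If `A` is integrally closed in a von Neumann regular ring `B`, then the image of `A` in `B ⧸ p`
is integrally closed. -/
theorem IsIntegrallyClosedIn.exists_mk_eq_of_monic (hAB : IsIntegrallyClosedIn A B)
    (hB : IsVonNeumannRegularRing B) (p : Ideal B) {f : A[X]} (hf : f.Monic) {y : B ⧸ p}
    (hy : f.eval₂ ((Ideal.Quotient.mk p).comp (algebraMap A B)) y = 0) :
    ∃ a : A, Ideal.Quotient.mk p (algebraMap A B a) = y := by
  obtain ⟨b, rfl⟩ := Ideal.Quotient.mk_surjective y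
  rw [← hom_eval₂, Ideal.Quotient.eq_zero_iff_mem] at hy
  obtain ⟨e, hee, he, hep⟩ := hB.exists_idempotent_mul_eq_zero hy
  have h := (f.map (algebraMap A B)).mul_eval_eq_mul_eval_of_mul_eq (e := e) (x := e * b) (y := b)
    (by rw [← mul_assoc, hee])
  rw [eval_map, eval_map, he] at h
  -- The cut-off `e * b` is a zero of the monic polynomial `X * f`.
  obtain ⟨a, ha⟩ := hAB.exists_algebraMap_eq_of_eval₂_eq_zero (f := X * f) (monic_X.mul hf)
    (b := e * b) (by rw [eval₂_mul, eval₂_X]; linear_combination b * h)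
  refine ⟨a, ?_⟩
  rw [ha, Ideal.Quotient.eq]
  have : e * b - b = -((1 - e) * b) := by ring
  rw [this]
  exact p.neg_mem (p.mul_mem_right b hep)

/-- The canonical map `A/(p ∩ A) → B/p` extends to the field of fractions of its source if `p` is
maximal. -/
theorem exists_isCanonicalQfMap (p : Ideal B) [hp : p.IsMaximal] :
    ∃ φ : QfRestrict A p →+* B ⧸ p, IsCanonicalQfMap A p φ := by
  let := Ideal.Quotient.field p
  let i : A ⧸ p.comap (algebraMap A B) →+* B ⧸ p := Ideal.quotientMap p (algebraMap A B) le_rfl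
  have hi : Function.Injective i := Ideal.quotientMap_injective
  refine ⟨IsFractionRing.lift hi, fun a => ?_⟩
  rw [IsFractionRing.lift_algebraMap]
  exact Ideal.quotientMap_mk

/-- A nonzero multiple `s • x` is integral over the image of `A`, hence lies in that image; divide
by `s`. -/
theorem IsCanonicalQfMap.mem_range_of_isAlgebraic (hAB : IsIntegrallyClosedIn A B)
    (hB : IsVonNeumannRegularRing B) (p : Ideal B) [hp : p.IsPrime]
    {φ : QfRestrict A p →+* B ⧸ p} (hφ : IsCanonicalQfMap A p φ) {x : B ⧸ p}
    (hx : ∃ h : (QfRestrict A p)[X], h ≠ 0 ∧ h.eval₂ φ x = 0) : x ∈ φ.range := by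
  have := hB.isMaximal_of_isPrime p
  let := Ideal.Quotient.field p
  let : Algebra (QfRestrict A p) (B ⧸ p) := φ.toAlgebra
  let : Algebra (A ⧸ p.comap (algebraMap A B)) (B ⧸ p) :=
    (φ.comp (algebraMap (A ⧸ p.comap (algebraMap A B)) (QfRestrict A p))).toAlgebra
  have : IsScalarTower (A ⧸ p.comap (algebraMap A B)) (QfRestrict A p) (B ⧸ p) :=
    IsScalarTower.of_algebraMap_eq fun _ => rfl
  have halg : IsAlgebraic (QfRestrict A p) x := hx
  have halg' : IsAlgebraic (A ⧸ p.comap (algebraMap A B)) x :=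
    (IsFractionRing.isAlgebraic_iff _ (QfRestrict A p) (B ⧸ p)).2 halg
  obtain ⟨s, hs, f, hf, hfx⟩ := halg'.exists_integral_multiple
  obtain ⟨F, rfl, -, hF⟩ := lifts_and_degree_eq_and_monic
    (mem_lifts_of_surjective Ideal.Quotient.mk_surjective f) hf
  rw [eval₂_map] at hfx
  have hcomp : (algebraMap (A ⧸ p.comap (algebraMap A B)) (B ⧸ p)).comp (Ideal.Quotient.mk _) =
      (Ideal.Quotient.mk p).comp (algebraMap A B) := RingHom.ext hφ
  rw [hcomp] at hfx
  obtain ⟨a, ha⟩ := hAB.exists_mk_eq_of_monic hB p hF hfx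
  have hs' : algebraMap (A ⧸ p.comap (algebraMap A B)) (QfRestrict A p) s ≠ 0 := by
    rwa [Ne, FaithfulSMul.algebraMap_eq_zero_iff]
  refine ⟨algebraMap (A ⧸ p.comap (algebraMap A B)) (QfRestrict A p) (Ideal.Quotient.mk _ a) /
    algebraMap (A ⧸ p.comap (algebraMap A B)) (QfRestrict A p) s, ?_⟩
  rw [map_div₀, hφ, ha, div_eq_iff ((map_ne_zero φ).2 hs'), Algebra.smul_def, mul_comm]
  rfl

theorem IsRealClosedRing.isRealClosed_qfRestrict (hAB : IsIntegrallyClosedIn A B)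
    (hB : IsVonNeumannRegularRing B) (hrc : IsRealClosedRing B) (p : Ideal B) [p.IsPrime] :
    IsRealClosed (QfRestrict A p) := by
  have := hB.isMaximal_of_isPrime p
  let := Ideal.Quotient.field p
  have := IsRealClosed.quotient_of_fractionRing p (hrc.isRealClosed_fractionRing p)
  obtain ⟨φ, hφ⟩ := exists_isCanonicalQfMap (A := A) p
  exact IsRealClosed.of_ringHom φ fun x hx => hφ.mem_range_of_isAlgebraic hAB hB p hx

end QfRestrict

/-! ### Total quotient rings -/

theorem IsCanonicalQfMap.bijective_of_isFractionRing {A T : Type*} [CommRing A] [CommRing T]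
    [Algebra A T] [IsFractionRing A T] (p : Ideal T) [hp : p.IsMaximal]
    {φ : QfRestrict A p →+* T ⧸ p} (hφ : IsCanonicalQfMap A p φ) : Function.Bijective φ := by
  let := Ideal.Quotient.field p
  refine ⟨φ.injective, fun x => ?_⟩
  obtain ⟨t, rfl⟩ := Ideal.Quotient.mk_surjective x
  obtain ⟨a, s, rfl⟩ := IsLocalization.exists_mk'_eq (nonZeroDivisors A) t
  have hs : Ideal.Quotient.mk p (algebraMap A T s) ≠ 0 := by
    rw [Ne, Ideal.Quotient.eq_zero_iff_mem]
    exact fun h => hp.ne_top (Ideal.eq_top_of_isUnit_mem p h (IsLocalization.map_units T s))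
  refine ⟨algebraMap (A ⧸ p.comap (algebraMap A T)) (QfRestrict A p) (Ideal.Quotient.mk _ a) /
    algebraMap (A ⧸ p.comap (algebraMap A T)) (QfRestrict A p) (Ideal.Quotient.mk _ (s : A)), ?_⟩
  rw [map_div₀, hφ, hφ, div_eq_iff hs, ← map_mul, IsLocalization.mk'_spec]

theorem IsFractionRing.isIntegrallyClosedIn_of_intermediate {A T B : Type*} [CommRing A]
    [CommRing T] [CommRing B] [Algebra A B] [Algebra A T] [Algebra T B] [IsScalarTower A T B]
    [IsFractionRing A T] (hAB : IsIntegrallyClosedIn A B)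
    (hTB : Function.Injective (algebraMap T B)) : IsIntegrallyClosedIn T B := by
  refine (isIntegrallyClosedIn_iff).2 ⟨hTB, fun {b} hb => ?_⟩
  obtain ⟨s, hs⟩ := IsIntegral.exists_multiple_integral_of_isLocalization (nonZeroDivisors A) b hb
  obtain ⟨a, ha⟩ := (IsIntegrallyClosedIn.isIntegral_iff (R := A)).1 hs
  refine ⟨IsLocalization.mk' T a s, ?_⟩
  have hu : IsUnit (algebraMap T B (algebraMap A T s)) :=
    (IsLocalization.map_units T s).map _
  refine hu.mul_right_injective ?_
  change algebraMap T B (algebraMap A T s) * _ = algebraMap T B (algebraMap A T s) * b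
  rw [← map_mul, IsLocalization.mk'_spec', ← IsScalarTower.algebraMap_apply,
    ← IsScalarTower.algebraMap_apply, ha, Submonoid.smul_def, Algebra.smul_def]

/-! ### Lattice operations as zeros of monic quadratics -/

namespace IsFRing

variable {R : Type*} [CommRing R] [Lattice R]

theorem mul_eq_zero_of_inf_eq_zero (hR : IsFRing R) {a b : R} (h : a ⊓ b = 0) : a * b = 0 := by
  have ha : 0 ≤ a := h ▸ inf_le_left
  have hb : 0 ≤ b := h ▸ inf_le_right
  have h1 := hR.mul_inf_eq_zero a b b h hb
  have h2 := hR.mul_inf_eq_zero b (b * a) a (by rwa [inf_comm]) ha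
  rwa [mul_comm b a, inf_idem] at h2

/-- The two factors are disjoint, so their product vanishes. Thus `a ⊔ b` is a zero of `(X - a) * (X
- b)` and lies in any integrally closed subring containing `a` and `b`. -/
theorem sup_sub_mul_sup_sub (hR : IsFRing R) (a b : R) : (a ⊔ b - a) * (a ⊔ b - b) = 0 := by
  have := hR.isOrderedRing
  refine hR.mul_eq_zero_of_inf_eq_zero (le_antisymm ?_ ?_)
  · have : a ⊔ b ≤ a ⊔ b - (a ⊔ b - a) ⊓ (a ⊔ b - b) :=
      sup_le (le_sub_comm.1 inf_le_left) (le_sub_comm.1 inf_le_right)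
    simpa using this
  · exact le_inf (sub_nonneg.2 le_sup_left) (sub_nonneg.2 le_sup_right)

theorem sub_inf_mul_sub_inf (hR : IsFRing R) (a b : R) : (a - a ⊓ b) * (b - a ⊓ b) = 0 := by
  have := hR.isOrderedRing
  refine hR.mul_eq_zero_of_inf_eq_zero (le_antisymm ?_ ?_)
  · have : (a - a ⊓ b) ⊓ (b - a ⊓ b) + a ⊓ b ≤ a ⊓ b :=
      le_inf (le_sub_iff_add_le.1 inf_le_left) (le_sub_iff_add_le.1 inf_le_right)
    exact nonpos_of_add_le_left this
  · exact le_inf (sub_nonneg.2 inf_le_left) (sub_nonneg.2 inf_le_right)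

end IsFRing

/-- A von Neumann regular ring that is integrally closed in a real closed von Neumann regular
ring is real closed. -/
theorem IsRealClosedRing.of_isIntegrallyClosedIn {T B : Type*} [CommRing T] [CommRing B]
    [Algebra T B] (hTB : IsIntegrallyClosedIn T B) (hT : IsVonNeumannRegularRing T)
    (hB : IsVonNeumannRegularRing B) (hrc : IsRealClosedRing B) : IsRealClosedRing T where
  isReduced :=
    haveI := hrc.isReduced
    isReduced_of_injective (algebraMap T B) (isIntegrallyClosedIn_iff.1 hTB).1
  exists_order := by
    obtain ⟨_, hf, hsq, hdvd⟩ := hrc.exists_order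
    have := hf.isOrderedRing
    have hinj : Function.Injective (algebraMap T B) := (isIntegrallyClosedIn_iff.1 hTB).1
    have hlift : ∀ (a b : T) (c : B),
        (c - algebraMap T B a) * (c - algebraMap T B b) = 0 → ∃ t, algebraMap T B t = c := by
      intro a b c h
      exact hTB.exists_algebraMap_eq_of_eval₂_eq_zero (f := (X - C a) * (X - C b))
        ((monic_X_sub_C a).mul (monic_X_sub_C b)) (by simpa [eval₂_mul] using h)
    choose s hs using fun a b : T => hlift a b _
      (hf.sup_sub_mul_sup_sub (algebraMap T B a) (algebraMap T B b))
    choose i hi using fun a b : T => hlift a b (algebraMap T B a ⊓ algebraMap T B b)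
      (by linear_combination hf.sub_inf_mul_sub_inf (algebraMap T B a) (algebraMap T B b))
    let : Max T := ⟨s⟩
    let : Min T := ⟨i⟩
    let : LE T := ⟨fun a b => algebraMap T B a ≤ algebraMap T B b⟩
    let : LT T := ⟨fun a b => algebraMap T B a < algebraMap T B b⟩
    let L : Lattice T := hinj.lattice (algebraMap T B) Iff.rfl Iff.rfl hs hi
    have hle : ∀ a b : T, a ≤ b ↔ algebraMap T B a ≤ algebraMap T B b := fun _ _ => Iff.rfl
    refine ⟨L, ⟨?_, fun a b c hab hc => ?_⟩, fun a => ?_, fun a b ha hab => ?_⟩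
    · have : IsOrderedAddMonoid T :=
        { add_le_add_left := fun a b h c => by
            rw [hle, map_add, map_add]
            exact add_le_add_left ((hle a b).1 h) _ }
      have : ZeroLEOneClass T := ⟨by simpa only [hle, map_zero, map_one] using (hsq 1).2 .one⟩
      refine IsOrderedRing.of_mul_nonneg fun a b ha hb => ?_
      rw [hle, map_zero] at *
      rw [map_mul]
      exact mul_nonneg ha hb
    · apply hinj
      have hab' : algebraMap T B a ⊓ algebraMap T B b = 0 := by
        rw [← map_zero (algebraMap T B), ← hab]
        exact (hi a b).symm
      rw [hle, map_zero] at hc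
      rw [map_zero, ← hf.mul_inf_eq_zero _ _ _ hab' hc, ← map_mul]
      exact hi _ _
    · rw [hle, map_zero, hsq]
      refine ⟨?_, fun h => h.map _⟩
      rintro ⟨r, hr⟩
      obtain ⟨t, rfl⟩ := hTB.exists_algebraMap_eq_of_eval₂_eq_zero (f := X ^ 2 - C a)
        (monic_X_pow_sub_C a two_ne_zero) (b := r) (by simp [hr, sq])
      exact ⟨t, hinj (by rw [hr, map_mul])⟩
    · rw [hle, map_zero] at ha
      -- The quotient `c` need not come from `T`. But `b * d` is an idempotent fixing `b`, hence
      -- fixing its multiple `a ^ 2`, so `d * a ^ 2` serves instead.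
      obtain ⟨c, hc⟩ := hdvd _ _ ha hab
      obtain ⟨d, hd⟩ := hT b
      refine ⟨d * a ^ 2, hinj ?_⟩
      have hd' := congrArg (algebraMap T B) hd
      simp only [map_mul, map_pow] at hd' ⊢
      linear_combination (1 - algebraMap T B b * algebraMap T B d) * hc - c * hd'
  isIntegrallyClosed_quotient p _ := by
    have := hT.isMaximal_of_isPrime p
    let := Ideal.Quotient.field p
    infer_instance
  isRealClosed_fractionRing p hp := by
    have hinj : Function.Injective (algebraMap T B) := (isIntegrallyClosedIn_iff.1 hTB).1
    -- Minimal primes, unlike arbitrary ones, always lift along an injective ring map.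
    have hmin : p ∈ minimalPrimes T := by
      refine ⟨⟨hp, bot_le⟩, fun q hq hqp => ?_⟩
      have := hq.1
      exact ((hT.isMaximal_of_isPrime q).eq_of_le hp.ne_top hqp).ge
    obtain ⟨q, hq, hqp⟩ := Ideal.exists_comap_eq_of_mem_minimalPrimes_of_injective hinj p hmin
    subst hqp
    exact hrc.isRealClosed_qfRestrict hTB hB q

theorem mainTheorem6 :
    -- (i) and (ii)
    (∀ (A : Type u) (B : Type v) [CommRing A] [CommRing B] [Algebra A B] [IsReduced A],
      IsIntegrallyClosedIn A B → IsVonNeumannRegularRing B → IsRealClosedRing B →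
        ((∀ f : Polynomial A, f.Monic → Odd f.natDegree → ∃ a : A, f.IsRoot a) ∧
          (∀ g : Polynomial B, g.Monic → Odd g.natDegree → ∃ b : B, g.IsRoot b)) ∧
        (∀ (p : Ideal B) [p.IsPrime],
          (∃ φ : QfRestrict A p →+* B ⧸ p, IsCanonicalQfMap A p φ ∧
            ∀ x : B ⧸ p, (∃ h : Polynomial (QfRestrict A p), h ≠ 0 ∧ h.eval₂ φ x = 0) →
              x ∈ φ.range) ∧
          IsRealClosed (QfRestrict A p))) ∧
    -- (iii), first part: `T` is the total quotient ring of `A`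
    (∀ (A : Type u) (T : Type w) [CommRing A] [CommRing T] [Algebra A T] [IsFractionRing A T]
      [IsReduced A],
      IsVonNeumannRegularRing T →
        ∀ (p : Ideal T) [p.IsPrime],
          ∃ φ : QfRestrict A p ≃+* T ⧸ p, IsCanonicalQfMap A p (φ : QfRestrict A p →+* T ⧸ p)) ∧
    -- (iii), second part: `j` makes `T` an intermediate ring of `A` and `B`
    (∀ (A : Type u) (B : Type v) (T : Type w) [CommRing A] [CommRing B] [CommRing T]
      [Algebra A B] [Algebra A T] [IsFractionRing A T] [IsReduced A],
      IsIntegrallyClosedIn A B → IsVonNeumannRegularRing B → IsRealClosedRing B →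
        IsVonNeumannRegularRing T →
        ∀ j : T →ₐ[A] B, Function.Injective j → IsRealClosedRing T) := by
  refine ⟨?_, ?_, ?_⟩
  · intro A B _ _ _ _ hAB hB hrc
    refine ⟨⟨fun f hf hodd => ?_, fun g hg hodd => hrc.exists_isRoot_of_odd_natDegree hB hg hodd⟩,
      fun p _ => ⟨?_, hrc.isRealClosed_qfRestrict hAB hB p⟩⟩
    · have hinj : Function.Injective (algebraMap A B) := (isIntegrallyClosedIn_iff.1 hAB).1
      obtain ⟨b, hb⟩ := hrc.exists_isRoot_of_odd_natDegree hB (hf.map (algebraMap A B))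
        (by rwa [natDegree_map_eq_of_injective hinj])
      rw [IsRoot, eval_map] at hb
      obtain ⟨a, rfl⟩ := hAB.exists_algebraMap_eq_of_eval₂_eq_zero hf hb
      exact ⟨a, hinj (by rw [map_zero, ← hb, eval₂_hom])⟩
    · have := hB.isMaximal_of_isPrime p
      obtain ⟨φ, hφ⟩ := exists_isCanonicalQfMap (A := A) p
      exact ⟨φ, hφ, fun x hx => hφ.mem_range_of_isAlgebraic hAB hB p hx⟩
  · intro A T _ _ _ _ _ hT p _
    have := hT.isMaximal_of_isPrime p
    obtain ⟨φ, hφ⟩ := exists_isCanonicalQfMap (A := A) p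
    exact ⟨RingEquiv.ofBijective φ (hφ.bijective_of_isFractionRing p), hφ⟩
  · intro A B T _ _ _ _ _ _ _ hAB hB hrc hT j hj
    let : Algebra T B := j.toRingHom.toAlgebra
    have : IsScalarTower A T B := IsScalarTower.of_algebraMap_eq fun a => (j.commutes a).symm
    exact IsRealClosedRing.of_isIntegrallyClosedIn
      (IsFractionRing.isIntegrallyClosedIn_of_intermediate (A := A) hAB hj) hT hB hrc
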